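/- Theorem 2.1. Let $X$ be a topological space, $Y$ a non-empty convex set in a Hausdorff real topological vector space, $J:X\times Y\to\mathbf{R}$, $\Phi:X\to\mathbf{R}$, and $a,b\in[0,+\infty]$ with $a<b$. For $y\in Y$ and $\lambda\in[0,+\infty[$ let $M_{\lambda,y}\subseteq X$ be the set of all global minima (minimum points) of the function $J(\cdot,y)+\lambda\Phi(\cdot)$ on $X$, and let $M_{+\infty,y}=\emptyset$. With the conventions $\inf\emptyset=+\infty$ and $\sup\emptyset=-\infty$, all infima and suprema being taken in $[-\infty,+\infty]$, put $$\alpha:=\sup_{y\in Y}\max\Big\{\inf_X\Phi,\ \sup_{M_{b,y}}\Phi\Big\},\qquad \beta:=\inf_{y\in Y}\min\Big\{\sup_X\Phi,\ \inf_{M_{a,y}}\Phi\Big\}.$$ Assume that either, for each $x\in X$, the function $J(x,\cdot)$ is continuous and quasi-concave on $Y$ (that is, $\{y\in Y: J(x,y)\ge\rho\}$ is convex for all $\rho\in\mathbf{R}$), or, for each $x\in X$, the function $J(x,\cdot)$ is concave on $Y$. Assume moreover that: - $\alpha<\beta$; - $\Phi$ is lower semicontinuous; - for each $\lambda\in{]a,b[}$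 and each $y\in Y$, the function $J(\cdot,y)$ is lower semicontinuous, and the function $J(\cdot,y)+\lambda\Phi(\cdot)$ is inf-compact (that is, all its sublevel sets $\{x\in X: J(x,y)+\lambda\Phi(x)\le\rho\}$, $\rho\in\mathbf{R}$, are compact) and admits a unique global minimum in $X$. Then, for each real $r\in{]\alpha,\beta[}$ and for each closed set $S\subseteq X$ satisfying $$\Phi^{-1}(r)\subseteq S\subseteq\Phi^{-1}(]-\infty,r]),$$ one has, in $[-\infty,+\infty]$, $$\sup_{y\in Y}\inf_{x\in S}J(x,y)=\inf_{x\in S}\sup_{y\in Y}J(x,y).$$ -/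

import Mathlib

open scoped NNReal ENNReal

namespace RicceriMinimax

/-- A real-valued function on a topological space is inf-compact if all its sublevel sets
`f⁻¹(]-∞, r])`, `r ∈ ℝ`, are compact. -/
def InfCompact {X : Type*} [TopologicalSpace X] (f : X → ℝ) : Prop :=
  ∀ r : ℝ, IsCompact (f ⁻¹' Set.Iic r)

/-- `x` is a global minimum (point) of `f`. -/
def IsGlobalMin {X : Type*} (f : X → ℝ) (x : X) : Prop :=
  ∀ u : X, f x ≤ f u

/-- The set `M_{l,y}` of all global minima of `J(·, y) + l Φ` if `l < ∞`, and the empty set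
if `l = ∞`. -/
def minSet {X E : Type*} (J : X → E → ℝ) (Φ : X → ℝ) (l : ℝ≥0∞) (y : E) : Set X :=
  {x | l ≠ ⊤ ∧ IsGlobalMin (fun u => J u y + l.toReal * Φ u) x}

/-- `α = sup_{y ∈ Y} max {inf_X Φ, sup_{M_{b,y}} Φ}`, an extended real number
(with `inf ∅ = +∞` and `sup ∅ = -∞`). -/
noncomputable def alpha {X E : Type*} (J : X → E → ℝ) (Φ : X → ℝ) (Y : Set E) (b : ℝ≥0∞) :
    EReal :=
  ⨆ y ∈ Y, max (⨅ x : X, (Φ x : EReal)) (⨆ x ∈ minSet J Φ b y, (Φ x : EReal))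

/-- `β = inf_{y ∈ Y} min {sup_X Φ, inf_{M_{a,y}} Φ}`, an extended real number
(with `inf ∅ = +∞` and `sup ∅ = -∞`). -/
noncomputable def beta {X E : Type*} (J : X → E → ℝ) (Φ : X → ℝ) (Y : Set E) (a : ℝ≥0∞) :
    EReal :=
  ⨅ y ∈ Y, min (⨆ x : X, (Φ x : EReal)) (⨅ x ∈ minSet J Φ a y, (Φ x : EReal))

end RicceriMinimax

/-! Fix `y`. The bounds `α < r < β` force the minimum points of `J(·,y) + lΦ` to have `Φ > r` for
some `l` near `a` and `Φ < r` for some `l` near `b` (or large, if `b = ∞`). A saddle point in `(x,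
l)` then yields `l ≥ 0` whose unique minimum point has `Φ = r` (`exists_multiplier`). Since `Φ ≤ r`
on `S`, that point lies in `S` and is the unique minimum of `J(·,y)` there, and `J(·,y)` is
inf-compact on `S`.

It remains to prove a minimax theorem on `S × Y` for functions with unique minima
(`exists_forall_le`). Compactness reduces it to finite subsets of `Y`. On a compact convex set where
the marginal `y ↦ min f(·,y)` is upper semicontinuous, a maximum point of the marginal gives a
saddle point (`exists_saddle`). This is checked along segments (`apply_one_le_of_marginal_max`),
where uniqueness of minima replaces continuity of the minimum point. In the merely concave case the
marginal may misbehave at the boundary of a simplex, so a slightly shrunken simplex is used, at the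
cost of an arbitrarily small error. -/

namespace RicceriMinimax

open Set Filter Topology

/-- `g` is bounded at each point of `K` by any upper bound of `g` on a half-open segment of `K`
issuing from that point. -/
def RadiallyLSCOn {E : Type*} [AddCommGroup E] [Module ℝ E] (K : Set E) (g : E → ℝ) : Prop :=
  ∀ p ∈ K, ∀ q ∈ K, ∀ c : ℝ, (∀ s ∈ Ioc (0 : ℝ) 1, g (p + s • (q - p)) ≤ c) → g p ≤ c

/-- The point `x` is the only global minimum of `g`. -/
def IsStrictMin {X : Type*} (g : X → ℝ) (x : X) : Prop :=
  ∀ u, u ≠ x → g x < g u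

lemma IsStrictMin.le {X : Type*} {g : X → ℝ} {x : X} (h : IsStrictMin g x) (u : X) :
    g x ≤ g u := by
  rcases eq_or_ne u x with rfl | hu
  · exact le_rfl
  · exact (h u hu).le

lemma _root_.QuasiconcaveOn.lt_of_lt_segment {E : Type*} [AddCommGroup E] [Module ℝ E] {K : Set E}
    {g : E → ℝ} (h : QuasiconcaveOn ℝ K g) {p q z : E} (hp : p ∈ K) (hq : q ∈ K)
    (hz : z ∈ segment ℝ p q) {c : ℝ} (h1 : c < g p) (h2 : c < g q) : c < g z := by
  have := (h (min (g p) (g q))).segment_subset ⟨hp, min_le_left _ _⟩ ⟨hq, min_le_right _ _⟩ hz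
  exact (lt_min h1 h2).trans_le this.2

lemma _root_.QuasiconcaveOn.le_of_le_segment {E : Type*} [AddCommGroup E] [Module ℝ E] {K : Set E}
    {g : E → ℝ} (h : QuasiconcaveOn ℝ K g) {p q z : E} (hp : p ∈ K) (hq : q ∈ K)
    (hz : z ∈ segment ℝ p q) {c : ℝ} (h1 : c ≤ g p) (h2 : c ≤ g q) : c ≤ g z :=
  ((h c).segment_subset ⟨hp, h1⟩ ⟨hq, h2⟩ hz).2

/-! ### Saddle inequality along a segment -/

section Interval

variable {X : Type*} [TopologicalSpace X] {F : X → ℝ → ℝ}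

/-- By quasi-concavity, the parts outside `U` of the sublevel sets at `t + s(q - t)` are nested
compact sets shrinking with `s`. Were none empty, a common point would satisfy `F x t ≤ M` by radial
semicontinuity, hence equal `x₀ ∈ U`. -/
lemma exists_forall_sublevel_subset
    (hqc : ∀ x, QuasiconcaveOn ℝ (Icc (0 : ℝ) 1) (F x))
    (hrad : ∀ x, RadiallyLSCOn (Icc (0 : ℝ) 1) (F x))
    (hlsc : ∀ t ∈ Icc (0 : ℝ) 1, LowerSemicontinuous fun x => F x t)
    (hcpt : ∀ t ∈ Icc (0 : ℝ) 1, InfCompact fun x => F x t)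
    {t q M : ℝ} (ht : t ∈ Icc (0 : ℝ) 1) (hq : q ∈ Icc (0 : ℝ) 1) {x₀ : X}
    (hx₀ : ∀ x, x ≠ x₀ → M < F x t) {U : Set X} (hU : IsOpen U) (hx₀U : x₀ ∈ U) :
    ∃ s₀ ∈ Ioc (0 : ℝ) 1, ∀ s ∈ Ioc 0 s₀, ∀ x, F x (t + s * (q - t)) ≤ M → x ∈ U := by
  by_contra! H
  have hmem : ∀ s ∈ Ioc (0 : ℝ) 1, t + s * (q - t) ∈ Icc (0 : ℝ) 1 := fun s hs =>
    (convex_Icc (0 : ℝ) 1).add_smul_sub_mem ht hq ⟨hs.1.le, hs.2⟩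
  let C : Ioc (0 : ℝ) 1 → Set X := fun s => Uᶜ ∩ (fun x => F x (t + s * (q - t))) ⁻¹' Iic M
  have hmono : ∀ s s' : Ioc (0 : ℝ) 1, s ≤ s' → C s ⊆ C s' := by
    rintro s s' hss x ⟨hxU, hx⟩
    refine ⟨hxU, ?_⟩
    by_contra hlt
    simp only [mem_preimage, mem_Iic, not_le] at hlt hx
    have hs'0 : (0 : ℝ) < s' := s'.2.1
    have hss' : (s : ℝ) ≤ s' := hss
    have hne : x ≠ x₀ := fun h => hxU (h ▸ hx₀U)
    refine absurd ((hqc x).lt_of_lt_segment ht (hmem s' s'.2) ?_ (hx₀ x hne) hlt) hx.not_gt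
    refine ⟨1 - s / s', s / s', sub_nonneg.2 (div_le_one_of_le₀ hss' hs'0.le),
      div_nonneg s.2.1.le hs'0.le, by ring, ?_⟩
    simp only [smul_eq_mul]
    field_simp
    ring
  have hne : ∀ s, (C s).Nonempty := by
    intro s₀
    obtain ⟨s, hs, x, hx, hxU⟩ := H s₀ s₀.2
    exact ⟨x, hmono ⟨s, hs.1, hs.2.trans s₀.2.2⟩ s₀ hs.2 ⟨hxU, hx⟩⟩
  have hclosed : ∀ s, IsClosed (C s) := fun s =>
    hU.isClosed_compl.inter ((hlsc _ (hmem s s.2)).isClosed_preimage M)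
  have hcomp : ∀ s, IsCompact (C s) := fun s =>
    (hcpt _ (hmem s s.2) M).inter_left hU.isClosed_compl
  have : Nonempty (Ioc (0 : ℝ) 1) := ⟨⟨1, by simp⟩⟩
  have hdir : Directed (· ⊇ ·) C := fun s s' =>
    ⟨min s s', hmono _ _ (min_le_left _ _), hmono _ _ (min_le_right _ _)⟩
  obtain ⟨x, hx⟩ :=
    IsCompact.nonempty_iInter_of_directed_nonempty_isCompact_isClosed C hdir hne hcomp hclosed
  rw [mem_iInter] at hx
  have hxt : F x t ≤ M := hrad x t ht q hq M fun s hs => (hx ⟨s, hs⟩).2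
  have : x = x₀ := by
    by_contra h
    exact absurd (hx₀ x h) hxt.not_gt
  exact (hx ⟨1, by simp⟩).1 (this ▸ hx₀U)

/-- If the marginal function of `F` on `[0, 1]` is maximal at `0`, then the minimum point of
`F (·, 0)` together with `0` satisfies the saddle inequality in the direction of `1`. -/
lemma apply_one_le_of_marginal_max
    (hqc : ∀ x, QuasiconcaveOn ℝ (Icc (0 : ℝ) 1) (F x))
    (hrad : ∀ x, RadiallyLSCOn (Icc (0 : ℝ) 1) (F x))
    (hlsc : ∀ t ∈ Icc (0 : ℝ) 1, LowerSemicontinuous fun x => F x t)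
    (hcpt : ∀ t ∈ Icc (0 : ℝ) 1, InfCompact fun x => F x t)
    {ξ : ℝ → X} (hξ : ∀ t ∈ Icc (0 : ℝ) 1, IsStrictMin (fun x => F x t) (ξ t))
    (hmax : ∀ t ∈ Icc (0 : ℝ) 1, F (ξ t) t ≤ F (ξ 0) 0)
    (husc : IsClosed {t ∈ Icc (0 : ℝ) 1 | F (ξ 0) 0 ≤ F (ξ t) t}) :
    F (ξ 0) 1 ≤ F (ξ 0) 0 := by
  by_contra! hlt
  set M := F (ξ 0) 0 with hM
  have h1 : (1 : ℝ) ∈ Icc (0 : ℝ) 1 := by simp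
  -- The supremum of `T` turns out to belong to `T`, yet `T` can always be prolonged to the right.
  let T : Set ℝ := {t ∈ Icc (0 : ℝ) 1 | M ≤ F (ξ t) t ∧ M < F (ξ t) 1}
  have h0T : (0 : ℝ) ∈ T := ⟨by simp, le_rfl, hlt⟩
  have hbdd : BddAbove T := ⟨1, fun t ht => ht.1.2⟩
  have hstrict : ∀ t ∈ Icc (0 : ℝ) 1, M ≤ F (ξ t) t → ∀ x, x ≠ ξ t → M < F x t :=
    fun t ht hMt x hx => hMt.trans_lt (hξ t ht x hx)
  have hopen : ∀ q ∈ Icc (0 : ℝ) 1, IsOpen {x | M < F x q} := fun q hq =>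
    (hlsc q hq).isOpen_preimage M
  set τ := sSup T with hτ
  have hτT : τ ∈ T := by
    by_contra hnot
    have hcl : τ ∈ closure T := csSup_mem_closure ⟨0, h0T⟩ hbdd
    have hτ1 : τ ∈ {t ∈ Icc (0 : ℝ) 1 | M ≤ F (ξ t) t} :=
      closure_minimal (t := {t ∈ Icc (0 : ℝ) 1 | M ≤ F (ξ t) t})
        (fun t ht => ⟨ht.1, ht.2.1⟩) husc hcl
    have hτz : F (ξ τ) 1 ≤ M := by
      by_contra! h
      exact hnot ⟨hτ1.1, hτ1.2, h⟩
    have hTlt : ∀ s ∈ T, s < τ := fun s hs =>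
      lt_of_le_of_ne (le_csSup hbdd hs) (by rintro rfl; exact hnot hs)
    have hne : ξ τ ≠ ξ 0 := by
      intro h
      rw [h] at hτz
      exact absurd hlt hτz.not_gt
    have h0 : (0 : ℝ) ∈ Icc (0 : ℝ) 1 := by simp
    -- Just left of `τ`, minimum points stay in `{F(·,0) > M}`. For a parameter of `T` they also lie
    -- in `{F(·,1) > M}`, so quasi-concavity lifts the marginal above its maximum `M`.
    obtain ⟨s₀, hs₀, hs⟩ := exists_forall_sublevel_subset hqc hrad hlsc hcpt hτ1.1 h0
      (hstrict τ hτ1.1 hτ1.2) (hopen 0 h0) (hstrict 0 h0 le_rfl _ hne)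
    have hτpos : 0 < τ := hTlt 0 h0T
    obtain ⟨s', hs'T, hs'⟩ := exists_lt_of_lt_csSup ⟨0, h0T⟩
      (show τ - s₀ * τ < sSup T by rw [← hτ]; nlinarith [hs₀.1])
    have hs'τ := hTlt s' hs'T
    have key := hs ((τ - s') / τ) ⟨div_pos (sub_pos.2 hs'τ) hτpos, by
      rw [div_le_iff₀ hτpos]; linarith⟩ (ξ s')
    have heq : τ + (τ - s') / τ * (0 - τ) = s' := by field_simp; ring
    rw [heq] at key
    have hM0 : M < F (ξ s') 0 := key (hmax s' hs'T.1)
    refine absurd ((hqc (ξ s')).lt_of_lt_segment h0 h1 ?_ hM0 hs'T.2.2) (hmax s' hs'T.1).not_gt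
    rw [segment_eq_Icc zero_le_one]
    exact hs'T.1
  have hτne : τ ≠ 1 := by
    intro h
    have h2 := hτT.2.2
    have h3 := hmax 1 h1
    rw [h] at h2
    exact absurd h2 h3.not_gt
  have hτlt : τ < 1 := lt_of_le_of_ne hτT.1.2 hτne
  obtain ⟨s₀, hs₀, hs⟩ := exists_forall_sublevel_subset hqc hrad hlsc hcpt hτT.1 h1
    (hstrict τ hτT.1 hτT.2.1) (hopen 1 h1) hτT.2.2
  have hmem : τ + s₀ * (1 - τ) ∈ Icc (0 : ℝ) 1 :=
    (convex_Icc (0 : ℝ) 1).add_smul_sub_mem hτT.1 h1 ⟨hs₀.1.le, hs₀.2⟩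
  have hM1 : M < F (ξ (τ + s₀ * (1 - τ))) 1 := hs s₀ ⟨hs₀.1, le_rfl⟩ _ (hmax _ hmem)
  have hnew : τ + s₀ * (1 - τ) ∈ T := by
    refine ⟨hmem, ?_, hM1⟩
    refine (hqc _).le_of_le_segment hτT.1 h1 ?_
      (hτT.2.1.trans ((hξ τ hτT.1).le _)) hM1.le
    rw [segment_eq_Icc hτT.1.2]
    exact ⟨by nlinarith [hs₀.1], hmem.2⟩
  have := le_csSup hbdd hnew
  rw [← hτ] at this
  nlinarith [hs₀.1]

end Interval

/-! ### Radial semicontinuity and marginal functions -/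

lemma RadiallyLSCOn.of_continuousOn {E : Type*} [AddCommGroup E] [Module ℝ E]
    [TopologicalSpace E] [IsTopologicalAddGroup E] [ContinuousSMul ℝ E] {K : Set E} {g : E → ℝ}
    (hK : Convex ℝ K) (hg : ContinuousOn g K) : RadiallyLSCOn K g := by
  intro p hp q hq c hc
  have h1 : Tendsto (fun s : ℝ => p + s • (q - p)) (𝓝[Ioc 0 1] 0) (𝓝[K] p) := by
    refine tendsto_nhdsWithin_iff.2 ⟨?_, ?_⟩
    · have : Continuous fun s : ℝ => p + s • (q - p) := by fun_prop
      simpa using (this.tendsto 0).mono_left nhdsWithin_le_nhds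
    · filter_upwards [self_mem_nhdsWithin] with s hs
      exact hK.add_smul_sub_mem hp hq ⟨hs.1.le, hs.2⟩
  have : (𝓝[Ioc (0 : ℝ) 1] 0).NeBot := by
    rw [nhdsWithin_Ioc_eq_nhdsGT zero_lt_one]
    infer_instance
  refine le_of_tendsto ((hg p hp).tendsto.comp h1) ?_
  filter_upwards [self_mem_nhdsWithin] with s hs using hc s hs

lemma RadiallyLSCOn.of_concaveOn {E : Type*} [AddCommGroup E] [Module ℝ E] {K : Set E}
    {g : E → ℝ} (hg : ConcaveOn ℝ K g) : RadiallyLSCOn K g := by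
  intro p hp q hq c hc
  have h1 : ∀ s ∈ Ioc (0 : ℝ) 1, (1 - s) * g p + s * g q ≤ c := by
    intro s hs
    refine le_trans ?_ (hc s hs)
    have := hg.2 hp hq (sub_nonneg.2 hs.2) hs.1.le (by ring)
    rw [smul_eq_mul, smul_eq_mul] at this
    convert this using 2
    module
  have h2 : Tendsto (fun s : ℝ => (1 - s) * g p + s * g q) (𝓝[Ioc 0 1] 0) (𝓝 (g p)) := by
    have : Continuous fun s : ℝ => (1 - s) * g p + s * g q := by fun_prop
    simpa using (this.tendsto 0).mono_left nhdsWithin_le_nhds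
  have : (𝓝[Ioc (0 : ℝ) 1] 0).NeBot := by
    rw [nhdsWithin_Ioc_eq_nhdsGT zero_lt_one]
    infer_instance
  refine le_of_tendsto h2 ?_
  filter_upwards [self_mem_nhdsWithin] with s hs using h1 s hs

lemma upperSemicontinuousOn_marginal {X E : Type*} [TopologicalSpace E] {K : Set E} {f : X → E → ℝ}
    (hf : ∀ x, ContinuousOn (f x) K)
    {ξ : E → X} (hξ : ∀ y ∈ K, IsStrictMin (fun x => f x y) (ξ y)) :
    UpperSemicontinuousOn (fun y => f (ξ y) y) K := by
  intro y hy c hc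
  filter_upwards [(hf (ξ y) y hy).tendsto.eventually (gt_mem_nhds hc), self_mem_nhdsWithin]
    with z hz hzK
  exact ((hξ z hzK).le (ξ y)).trans_lt hz

lemma concaveOn_marginal {X E : Type*} [AddCommGroup E] [Module ℝ E] {K : Set E} (hK : Convex ℝ K) {f : X → E → ℝ}
    (hf : ∀ x, ConcaveOn ℝ K (f x))
    {ξ : E → X} (hξ : ∀ y ∈ K, IsStrictMin (fun x => f x y) (ξ y)) :
    ConcaveOn ℝ K fun y => f (ξ y) y := by
  refine ⟨hK, fun p hp q hq s t hs ht hst => ?_⟩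
  refine le_trans ?_ ((hf _).2 hp hq hs ht hst)
  have h1 := (hξ p hp).le (ξ (s • p + t • q))
  have h2 := (hξ q hq).le (ξ (s • p + t • q))
  simp only [smul_eq_mul]
  gcongr

/-! ### Saddle points on compact convex sets -/

section Saddle

variable {X : Type*} [TopologicalSpace X] {E : Type*} [AddCommGroup E] [Module ℝ E]
  [TopologicalSpace E] [IsTopologicalAddGroup E] [ContinuousSMul ℝ E]

/-- On a compact convex set on which the marginal function is upper semicontinuous, the minimum
point of `f` at some maximum point of the marginal function satisfies the saddle inequality. -/
lemma exists_saddle [T2Space E] {K : Set E} (hKne : K.Nonempty) (hK : Convex ℝ K)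
    (hKc : IsCompact K) {f : X → E → ℝ}
    (hqc : ∀ x, QuasiconcaveOn ℝ K (f x)) (hrad : ∀ x, RadiallyLSCOn K (f x))
    (hlsc : ∀ y ∈ K, LowerSemicontinuous fun x => f x y)
    (hcpt : ∀ y ∈ K, InfCompact fun x => f x y)
    {ξ : E → X} (hξ : ∀ y ∈ K, IsStrictMin (fun x => f x y) (ξ y))
    (husc : UpperSemicontinuousOn (fun y => f (ξ y) y) K) :
    ∃ p ∈ K, ∀ z ∈ K, f (ξ p) z ≤ f (ξ p) p := by
  obtain ⟨p, hp, hmax⟩ := husc.exists_isMaxOn hKne hKc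
  refine ⟨p, hp, fun z hz => ?_⟩
  have hmem : ∀ t ∈ Icc (0 : ℝ) 1, p + t • (z - p) ∈ K := fun t ht =>
    hK.add_smul_sub_mem hp hz ht
  have hcont : Continuous fun t : ℝ => p + t • (z - p) := by fun_prop
  have hline : ∀ t : ℝ, AffineMap.lineMap p z t = p + t • (z - p) := fun t => by
    rw [AffineMap.lineMap_apply_module']; abel
  have key := apply_one_le_of_marginal_max (F := fun x t => f x (p + t • (z - p)))
    (ξ := fun t => ξ (p + t • (z - p))) ?_ ?_ (fun t ht => hlsc _ (hmem t ht))
    (fun t ht => hcpt _ (hmem t ht)) (fun t ht => hξ _ (hmem t ht)) ?_ ?_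
  · simpa using key
  · intro x c
    have h1 := (convex_Icc (0 : ℝ) 1).inter ((hqc x c).affine_preimage (AffineMap.lineMap p z))
    have h2 : Icc (0 : ℝ) 1 ∩ AffineMap.lineMap p z ⁻¹' {y | y ∈ K ∧ c ≤ f x y} =
        {t | t ∈ Icc (0 : ℝ) 1 ∧ c ≤ f x (p + t • (z - p))} := by
      ext t
      simp only [mem_ofPred_eq, mem_inter_iff, mem_preimage, hline]
      exact ⟨fun h => ⟨h.1, h.2.2⟩, fun h => ⟨h.1, hmem t h.1, h.2⟩⟩
    rw [h2] at h1
    exact h1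
  · intro x t ht q hq c hc
    refine hrad x _ (hmem t ht) _ (hmem q hq) c fun s hs => ?_
    convert hc s hs using 2
    simp only [smul_eq_mul]
    module
  · intro t ht
    simpa using hmax (hmem t ht)
  · obtain ⟨V, hV, hVK⟩ := upperSemicontinuousOn_iff_preimage_Ici.1 husc (f (ξ p) p)
    have h1 : IsClosed (Icc (0 : ℝ) 1 ∩ (fun t : ℝ => p + t • (z - p)) ⁻¹' V) :=
      isClosed_Icc.inter (hV.preimage hcont)
    convert h1 using 1
    ext t
    have := Set.ext_iff.1 hVK (p + t • (z - p))
    simp only [mem_inter_iff, mem_preimage, mem_Ici] at this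
    simp only [zero_smul, add_zero, mem_ofPred_eq, mem_inter_iff, mem_preimage]
    constructor
    · exact fun h => ⟨h.1, (this.1 ⟨hmem t h.1, h.2⟩).2⟩
    · exact fun h => ⟨h.1, (this.2 ⟨hmem t h.1, h.2⟩).2⟩

lemma exists_le_on_finite_of_continuousOn [T2Space E] {Y : Set E} (hY : Convex ℝ Y) {f : X → E → ℝ}
    (hf : ∀ x, ContinuousOn (f x) Y) (hqc : ∀ x, QuasiconcaveOn ℝ Y (f x))
    (hlsc : ∀ y ∈ Y, LowerSemicontinuous fun x => f x y)
    (hcpt : ∀ y ∈ Y, InfCompact fun x => f x y)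
    {ξ : E → X} (hξ : ∀ y ∈ Y, IsStrictMin (fun x => f x y) (ξ y))
    {ρ : ℝ} (hρ : ∀ y ∈ Y, f (ξ y) y ≤ ρ) (s : Finset E) (hs : s.Nonempty) (hsY : (s : Set E) ⊆ Y) :
    ∃ x, ∀ y ∈ s, f x y ≤ ρ := by
  have hK : convexHull ℝ (s : Set E) ⊆ Y := convexHull_min hsY hY
  obtain ⟨p, hp, h⟩ := exists_saddle (K := convexHull ℝ (s : Set E))
    (hs.to_set.convexHull) (convex_convexHull ℝ _) (s.finite_toSet.isCompact_convexHull (𝕜 := ℝ))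
    (fun x c => by
      convert (convex_convexHull ℝ (s : Set E)).inter (hqc x c) using 1
      ext y
      exact ⟨fun h => ⟨h.1, hK h.1, h.2⟩, fun h => ⟨h.1, h.2.2⟩⟩)
    (fun x => .of_continuousOn (convex_convexHull ℝ _) ((hf x).mono hK))
    (fun y hy => hlsc y (hK hy)) (fun y hy => hcpt y (hK hy)) (fun y hy => hξ y (hK hy))
    (upperSemicontinuousOn_marginal (fun x => (hf x).mono hK) fun y hy => hξ y (hK hy))
  exact ⟨ξ p, fun y hy => (h y (subset_convexHull ℝ _ hy)).trans (hρ p (hK hp))⟩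

end Saddle

/-! ### The concave case -/

/-- A concave function on the standard simplex is upper semicontinuous along the points whose
coordinates are bounded away from zero. -/
lemma upperSemicontinuousOn_of_concaveOn_stdSimplex {ι : Type*} [Fintype ι] {m : (ι → ℝ) → ℝ}
    (hm : ConcaveOn ℝ (stdSimplex ℝ ι) m) {C : ℝ} (hC : ∀ q ∈ stdSimplex ℝ ι, C ≤ m q)
    {δ : ℝ} (hδ : 0 < δ) :
    UpperSemicontinuousOn m {q ∈ stdSimplex ℝ ι | ∀ i, δ ≤ q i} := by
  intro p hp c hc
  obtain ⟨t, ht0, ht1, ht⟩ : ∃ t : ℝ, 0 < t ∧ t < 1 ∧ m p < (1 - t) * c + t * C := by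
    have hcont : Continuous fun t : ℝ => (1 - t) * c + t * C := by fun_prop
    have h1 : ∀ᶠ t in 𝓝[>] (0 : ℝ), m p < (1 - t) * c + t * C :=
      nhdsWithin_le_nhds ((hcont.tendsto 0).eventually (lt_mem_nhds (by simpa using hc)))
    obtain ⟨t, ht, ht'⟩ := (h1.and (Ioo_mem_nhdsGT zero_lt_one)).exists
    exact ⟨t, ht'.1, ht'.2, ht⟩
  have hev : ∀ᶠ q in 𝓝 p, ∀ i, 0 < p i - (1 - t) * q i := by
    refine eventually_all.2 fun i => ?_
    have hcont : Continuous fun q : ι → ℝ => p i - (1 - t) * q i := by fun_prop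
    refine (hcont.tendsto p).eventually (lt_mem_nhds ?_)
    have := hp.2 i
    nlinarith
  filter_upwards [nhdsWithin_le_nhds hev, self_mem_nhdsWithin] with q hq hqK
  by_contra! hcq
  -- Chosen so that `p = (1 - t) q + t w`. It lies in the simplex for `q` near `p` because the
  -- coordinates of `p` are positive.
  let w : ι → ℝ := fun i => (p i - (1 - t) * q i) / t
  have hw : w ∈ stdSimplex ℝ ι := by
    refine ⟨fun i => (div_pos (hq i) ht0).le, ?_⟩
    simp only [w]
    rw [← Finset.sum_div, Finset.sum_sub_distrib, ← Finset.mul_sum, hp.1.2, hqK.1.2]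
    field_simp
    ring
  have h1 := hm.2 hqK.1 hw (sub_nonneg.2 ht1.le) ht0.le (by ring)
  have h2 : (1 - t) • q + t • w = p := by
    ext i
    simp only [w, Pi.add_apply, Pi.smul_apply, smul_eq_mul]
    field_simp
    ring
  rw [h2, smul_eq_mul, smul_eq_mul] at h1
  have h3 := hC w hw
  nlinarith

section Concave

variable {X : Type*} [TopologicalSpace X] {E : Type*} [AddCommGroup E] [Module ℝ E]

/-- Each vertex is pulled towards the barycenter by a factor `τ`. A saddle point on the shrunken
simplex bounds `f` at the pulled vertices by `ρ₁`, and concavity transfers this to the true vertices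
with bound `ρ₂`. -/
lemma exists_le_on_finite_of_concaveOn {Y : Set E} (hY : Convex ℝ Y) {f : X → E → ℝ}
    (hf : ∀ x, ConcaveOn ℝ Y (f x))
    (hlsc : ∀ y ∈ Y, LowerSemicontinuous fun x => f x y)
    (hcpt : ∀ y ∈ Y, InfCompact fun x => f x y)
    {ξ : E → X} (hξ : ∀ y ∈ Y, IsStrictMin (fun x => f x y) (ξ y))
    {ρ₁ ρ₂ : ℝ} (hρ : ∀ y ∈ Y, f (ξ y) y ≤ ρ₁) (hρ₁₂ : ρ₁ < ρ₂)
    (s : Finset E) (hs : s.Nonempty) (hsY : (s : Set E) ⊆ Y) :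
    ∃ x, ∀ y ∈ s, f x y ≤ ρ₂ := by
  classical
  have hsne : Nonempty s := hs.to_subtype
  let φ : (s → ℝ) →ₗ[ℝ] E := Fintype.linearCombination ℝ fun i : s => (i : E)
  have hφ : ∀ q, φ q = ∑ i, q i • (i : E) := fun q => rfl
  have hφY : ∀ q ∈ stdSimplex ℝ s, φ q ∈ Y := fun q hq => by
    rw [hφ]
    exact hY.sum_mem (fun i _ => hq.1 i) hq.2 fun i _ => hsY i.2
  let G : X → (s → ℝ) → ℝ := fun x q => f x (φ q)
  have hGc : ∀ x, ConcaveOn ℝ (stdSimplex ℝ s) (G x) := fun x =>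
    ((hf x).comp_linearMap φ).subset hφY (convex_stdSimplex ℝ s)
  have hGξ : ∀ q ∈ stdSimplex ℝ s, IsStrictMin (fun x => G x q) (ξ (φ q)) := fun q hq =>
    hξ _ (hφY q hq)
  have hmc := concaveOn_marginal (convex_stdSimplex ℝ s) hGc (ξ := fun q => ξ (φ q)) hGξ
  let e : s → s → ℝ := fun i => Pi.single i 1
  have he : ∀ i, e i ∈ stdSimplex ℝ s := fun i => single_mem_stdSimplex ℝ i
  have hφe : ∀ i, φ (e i) = i := fun i => by
    simp [φ, e, Fintype.linearCombination_apply_single]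
  let C : ℝ := Finset.univ.inf' Finset.univ_nonempty fun i => G (ξ (φ (e i))) (e i)
  have hC : ∀ q ∈ stdSimplex ℝ s, C ≤ G (ξ (φ q)) q := by
    intro q hq
    have h1 := hmc.le_map_sum (t := Finset.univ) (w := q) (p := e) (fun i _ => hq.1 i) hq.2
      fun i _ => he i
    have h2 : ∑ i, q i • e i = q := by
      ext j
      simp [e, Finset.sum_apply, Pi.single_apply]
    rw [h2] at h1
    refine le_trans ?_ h1
    calc C = ∑ i, q i * C := by rw [← Finset.sum_mul, hq.2, one_mul]
      _ ≤ _ := Finset.sum_le_sum fun i _ => mul_le_mul_of_nonneg_left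
        (Finset.inf'_le _ (Finset.mem_univ i)) (hq.1 i)
  let n : ℝ := Fintype.card s
  have hn : 0 < n := Nat.cast_pos.2 Fintype.card_pos
  let b : s → ℝ := fun _ => n⁻¹
  have hb : b ∈ stdSimplex ℝ s := ⟨fun _ => (inv_pos.2 hn).le, by
    simp only [b, Finset.sum_const, Finset.card_univ, nsmul_eq_mul]
    exact mul_inv_cancel₀ hn.ne'⟩
  let D : ℝ := G (ξ (φ b)) b
  have hD : D ≤ ρ₁ := hρ _ (hφY b hb)
  have hD₂ : 0 < 2 * (ρ₂ - D) := by linarith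
  -- The transfer needs `(ρ₁ - τ D) / (1 - τ) ≤ ρ₂`, that is `τ (ρ₂ - D) ≤ ρ₂ - ρ₁`. The factor 2
  -- keeps `τ < 1` even when `D = ρ₁`.
  let τ : ℝ := (ρ₂ - ρ₁) / (2 * (ρ₂ - D))
  have hτ0 : 0 < τ := div_pos (by linarith) hD₂
  have hτ1 : τ < 1 := by
    rw [div_lt_one hD₂]
    linarith
  have hτ : τ * (2 * (ρ₂ - D)) = ρ₂ - ρ₁ := div_mul_cancel₀ _ hD₂.ne'
  let K : Set (s → ℝ) := {q ∈ stdSimplex ℝ s | ∀ i, τ / n ≤ q i}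
  have hKsub : K ⊆ stdSimplex ℝ s := fun q hq => hq.1
  have hKeq : K = stdSimplex ℝ s ∩ Ici (fun _ => τ / n) := rfl
  have hKconv : Convex ℝ K := hKeq ▸ (convex_stdSimplex ℝ s).inter (convex_Ici _)
  have hKcomp : IsCompact K := hKeq ▸ (isCompact_stdSimplex ℝ s).inter_right isClosed_Ici
  have heK : ∀ i, (1 - τ) • e i + τ • b ∈ K := fun i => by
    refine ⟨convex_stdSimplex ℝ s (he i) hb (sub_nonneg.2 hτ1.le) hτ0.le (by ring), fun j => ?_⟩
    have := mul_nonneg (sub_nonneg.2 hτ1.le) ((he i).1 j)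
    simp only [Pi.add_apply, Pi.smul_apply, smul_eq_mul, b, div_eq_mul_inv]
    linarith
  have hGK : ∀ x, ConcaveOn ℝ K (G x) := fun x => (hGc x).subset hKsub hKconv
  obtain ⟨p, hp, h⟩ := exists_saddle (ξ := fun q => ξ (φ q)) ⟨_, heK hsne.some⟩ hKconv hKcomp
    (fun x => (hGK x).quasiconcaveOn) (fun x => .of_concaveOn (hGK x))
    (fun q hq => hlsc _ (hφY q hq.1)) (fun q hq => hcpt _ (hφY q hq.1))
    (fun q hq => hGξ q hq.1)
    (upperSemicontinuousOn_of_concaveOn_stdSimplex hmc hC (div_pos hτ0 hn))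
  refine ⟨ξ (φ p), fun y hy => ?_⟩
  have h1 := (h _ (heK ⟨y, hy⟩)).trans (hρ _ (hφY p hp.1))
  have h2 := (hGc (ξ (φ p))).2 (he ⟨y, hy⟩) hb (sub_nonneg.2 hτ1.le) hτ0.le (by ring)
  have h3 : D ≤ G (ξ (φ p)) b := (hGξ b hb).le _
  have h4 : G (ξ (φ p)) (e ⟨y, hy⟩) = f (ξ (φ p)) y := by
    simp only [G, hφe]
  rw [smul_eq_mul, smul_eq_mul, h4] at h2
  by_contra! hlt
  nlinarith

end Concave

/-! ### Existence of the multiplier -/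

lemma _root_.LowerSemicontinuous.le_of_tendsto {X ι : Type*} [TopologicalSpace X] {h : X → ℝ}
    (hh : LowerSemicontinuous h) {L : Filter ι} [L.NeBot] {ξ : ι → X} {x : X}
    (hξ : Tendsto ξ L (𝓝 x)) {v : ι → ℝ} {B : ℝ} (hv : Tendsto v L (𝓝 B))
    (hle : ∀ᶠ l in L, h (ξ l) ≤ v l) : h x ≤ B := by
  by_contra! hlt
  obtain ⟨c, hBc, hcx⟩ := exists_between hlt
  obtain ⟨l, h1, h2, h3⟩ := ((hξ.eventually (hh x c hcx)).and
    ((hv.eventually (gt_mem_nhds hBc)).and hle)).exists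
  linarith

lemma _root_.LowerSemicontinuous.add_mul_const {X : Type*} [TopologicalSpace X] {g Φ : X → ℝ}
    (hg : LowerSemicontinuous g) (hΦ : LowerSemicontinuous Φ) {l : ℝ} (hl : 0 ≤ l) :
    LowerSemicontinuous fun x => g x + l * Φ x :=
  hg.add ((continuous_const_mul l).comp_lowerSemicontinuous hΦ (monotone_mul_left_of_nonneg hl))

lemma InfCompact.exists_ultrafilter_tendsto {X ι : Type*} [TopologicalSpace X] {h : X → ℝ}
    (hh : InfCompact h) {L : Filter ι} [L.NeBot] {ξ : ι → X} {B : ℝ}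
    (hB : ∀ᶠ l in L, h (ξ l) ≤ B) :
    ∃ U : Ultrafilter ι, (U : Filter ι) ≤ L ∧ ∃ x, Tendsto ξ U (𝓝 x) := by
  have hU : (Ultrafilter.of L : Filter ι) ≤ L := Ultrafilter.of_le L
  obtain ⟨x, -, hx⟩ := (hh B).ultrafilter_le_nhds ((Ultrafilter.of L).map ξ)
    (le_principal_iff.2 (Ultrafilter.mem_map.2 (hU hB)))
  exact ⟨_, hU, x, hx⟩

/-- Covers `b = ∞`: a large enough penalty makes any point with `Φ ≥ r` lose against `u`. -/
lemma exists_lt_of_isGlobalMin {X : Type*} {g Φ : X → ℝ} {l₀ r : ℝ} {x₀ : X}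
    (hx₀ : IsGlobalMin (fun x => g x + l₀ * Φ x) x₀)
    {ξ : ℝ → X} (hξ : ∀ l ∈ Ioi l₀, IsGlobalMin (fun x => g x + l * Φ x) (ξ l))
    (hr : ∃ u, Φ u < r) : ∃ l ∈ Ioi l₀, Φ (ξ l) < r := by
  by_contra! H
  obtain ⟨u, hu⟩ := hr
  set d := g u + l₀ * Φ u - (g x₀ + l₀ * Φ x₀) with hd
  have hd0 : 0 ≤ d := sub_nonneg.2 (hx₀ u)
  have hru : 0 < r - Φ u := sub_pos.2 hu
  have hs : 0 < (d + 1) / (r - Φ u) := by positivity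
  have hl : l₀ + (d + 1) / (r - Φ u) ∈ Ioi l₀ := lt_add_of_pos_right _ hs
  have h1 := hξ _ hl u
  have h2 := mul_le_mul_of_nonneg_left (H _ hl) hs.le
  have h3 := hx₀ (ξ (l₀ + (d + 1) / (r - Φ u)))
  have h4 : (d + 1) / (r - Φ u) * (r - Φ u) = d + 1 := div_mul_cancel₀ _ hru.ne'
  simp only at h1 h3
  linarith

/-- The minimum points of `g + l Φ` carry smaller values of `Φ` for larger `l`. -/
lemma le_of_gt_of_lt {X : Type*} {g Φ : X → ℝ} {l₁ l₂ r : ℝ} {x₁ x₂ : X}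
    (hx₁ : IsStrictMin (fun x => g x + l₁ * Φ x) x₁)
    (hx₂ : IsStrictMin (fun x => g x + l₂ * Φ x) x₂) (h₁ : r < Φ x₁) (h₂ : Φ x₂ < r) :
    l₁ ≤ l₂ := by
  have hne : x₂ ≠ x₁ := by
    rintro rfl
    exact lt_asymm h₁ h₂
  have h3 := hx₁ x₂ hne
  have h4 := hx₂ x₁ hne.symm
  simp only at h3 h4
  by_contra! hlt
  nlinarith

section Multiplier

variable {X : Type*} [TopologicalSpace X] {g Φ : X → ℝ}

/-- Otherwise the minimum points remain, as `l ↑ b`, in a compact sublevel set of `g + l₀Φ`, and a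
limit point minimizes `g + bΦ` with `Φ ≥ r`. -/
lemma exists_lt_of_lt_on_minima_right (hg : LowerSemicontinuous g) (hΦ : LowerSemicontinuous Φ)
    {l₀ b r : ℝ} (hl₀ : 0 ≤ l₀) (hlb : l₀ < b) (hcpt : InfCompact fun x => g x + l₀ * Φ x)
    {ξ : ℝ → X} (hξ : ∀ l ∈ Ioo l₀ b, IsGlobalMin (fun x => g x + l * Φ x) (ξ l))
    (hb : ∀ x, IsGlobalMin (fun x => g x + b * Φ x) x → Φ x < r) :
    ∃ l ∈ Ioo l₀ b, Φ (ξ l) < r := by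
  by_contra! H
  let u₀ := ξ l₀
  have hbound : ∀ l ∈ Ioo l₀ b, ∀ k ≤ Φ (ξ l), ∀ u,
      g (ξ l) + l₀ * Φ (ξ l) ≤ g u + l₀ * Φ u + (l - l₀) * (Φ u - k) := by
    intro l hl k hk u
    have h1 := hξ l hl u
    have h2 := mul_le_mul_of_nonneg_left hk (sub_nonneg.2 hl.1.le)
    simp only at h1
    linarith
  obtain ⟨U, hU, x, hx⟩ := hcpt.exists_ultrafilter_tendsto (L := 𝓝[<] b) (ξ := ξ)
    (B := g u₀ + l₀ * Φ u₀ + (b - l₀) * |Φ u₀ - r|) (by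
      filter_upwards [Ioo_mem_nhdsLT hlb] with l hl
      refine (hbound l hl r (H l hl) u₀).trans (add_le_add le_rfl ?_)
      exact (mul_le_mul_of_nonneg_left (le_abs_self _) (sub_nonneg.2 hl.1.le)).trans
        (mul_le_mul_of_nonneg_right (sub_le_sub_right hl.2.le _) (abs_nonneg _)))
  have hIoo : ∀ᶠ l in (U : Filter ℝ), l ∈ Ioo l₀ b := hU (Ioo_mem_nhdsLT hlb)
  -- Semicontinuity of `Φ` alone does not carry `Φ ≥ r` to the limit. Taking `k = r`, `u = x` here
  -- does, and `k` slightly below `Φ x` gives minimality.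
  have key : ∀ k, (∀ᶠ l in (U : Filter ℝ), k ≤ Φ (ξ l)) → ∀ u,
      g x + l₀ * Φ x ≤ g u + l₀ * Φ u + (b - l₀) * (Φ u - k) := by
    intro k hk u
    have hcont : Continuous fun l : ℝ => g u + l₀ * Φ u + (l - l₀) * (Φ u - k) := by fun_prop
    refine (hg.add_mul_const hΦ hl₀).le_of_tendsto hx
      ((hcont.tendsto b).mono_left (hU.trans nhdsWithin_le_nhds)) ?_
    filter_upwards [hIoo, hk] with l hl hkl using hbound l hl k hkl u
  have hbl : 0 < b - l₀ := sub_pos.2 hlb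
  have hrx : r ≤ Φ x := by
    have := key r (hIoo.mono H) x
    by_contra! h
    nlinarith
  refine absurd (hb x fun u => ?_) hrx.not_gt
  simp only
  by_contra! h
  set d := g x + b * Φ x - (g u + b * Φ u) with hd
  have hd0 : 0 < d := sub_pos.2 h
  have h1 := key (Φ x - d / (2 * (b - l₀)))
    ((hx.eventually (hΦ x _ (sub_lt_self _ (by positivity)))).mono fun _ h => le_of_lt h) u
  have h2 : (b - l₀) * (d / (2 * (b - l₀))) = d / 2 := by field_simp
  nlinarith

lemma exists_gt_of_gt_on_minima_left (hg : LowerSemicontinuous g) (hΦ : LowerSemicontinuous Φ)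
    {l₀ a r : ℝ} (ha₀ : 0 ≤ a) (hal : a < l₀) (hcpt : InfCompact fun x => g x + l₀ * Φ x)
    {ξ : ℝ → X} (hξ : ∀ l ∈ Ioo a l₀, IsGlobalMin (fun x => g x + l * Φ x) (ξ l))
    (ha : ∀ x, IsGlobalMin (fun x => g x + a * Φ x) x → r < Φ x) :
    ∃ l ∈ Ioo a l₀, r < Φ (ξ l) := by
  by_contra! H
  let u₀ := ξ l₀
  obtain ⟨U, hU, x, hx⟩ := hcpt.exists_ultrafilter_tendsto (L := 𝓝[>] a) (ξ := ξ)
    (B := g u₀ + l₀ * Φ u₀ + (l₀ - a) * |r - Φ u₀|) (by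
      filter_upwards [Ioo_mem_nhdsGT hal] with l hl
      have h1 := hξ l hl u₀
      have h2 := mul_le_mul_of_nonneg_left (H l hl) (sub_nonneg.2 hl.2.le)
      have h3 := (mul_le_mul_of_nonneg_left (le_abs_self (r - Φ u₀)) (sub_nonneg.2 hl.2.le)).trans
        (mul_le_mul_of_nonneg_right (sub_le_sub_left hl.1.le l₀) (abs_nonneg _))
      simp only at h1
      linarith)
  have hIoo : ∀ᶠ l in (U : Filter ℝ), l ∈ Ioo a l₀ := hU (Ioo_mem_nhdsGT hal)
  have hxr : Φ x ≤ r := hΦ.le_of_tendsto hx tendsto_const_nhds (hIoo.mono H)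
  refine absurd (ha x fun u => ?_) hxr.not_gt
  -- Any eventual lower bound of `Φ (ξ l)` would do; `Φ x - 1` is one by semicontinuity.
  have hcont : Continuous fun l : ℝ => g u + a * Φ u + (l - a) * (Φ u - (Φ x - 1)) := by fun_prop
  have hlim := (hcont.tendsto a).mono_left (hU.trans nhdsWithin_le_nhds)
  simp only [sub_self, zero_mul, add_zero] at hlim
  refine (hg.add_mul_const hΦ ha₀).le_of_tendsto hx hlim ?_
  filter_upwards [hIoo, hx.eventually (hΦ x _ (sub_one_lt _))] with l hl hl'
  have h1 := hξ l hl u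
  have h2 := mul_le_mul_of_nonneg_left (le_of_lt hl') (sub_nonneg.2 hl.1.le)
  simp only at h1
  linarith

/-- Between a parameter whose minimum point has `Φ > r` and one whose minimum point has `Φ < r`
there is a parameter whose minimum point has `Φ = r`. -/
lemma exists_mem_Icc_eq (hg : LowerSemicontinuous g) (hΦ : LowerSemicontinuous Φ)
    {l₁ l₂ r : ℝ} (hl₁ : 0 ≤ l₁) (hl : l₁ ≤ l₂)
    (hcpt : ∀ l ∈ Icc l₁ l₂, InfCompact fun x => g x + l * Φ x)
    {ξ : ℝ → X} (hξ : ∀ l ∈ Icc l₁ l₂, IsStrictMin (fun x => g x + l * Φ x) (ξ l))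
    (h₁ : r < Φ (ξ l₁)) (h₂ : Φ (ξ l₂) < r) : ∃ l ∈ Icc l₁ l₂, Φ (ξ l) = r := by
  have hconc : ∀ x, ConcaveOn ℝ (Icc l₁ l₂) fun l => g x + l * (Φ x - r) := fun x =>
    ⟨convex_Icc _ _, fun p _ q _ s t _ _ hst => le_of_eq (by
      simp only [smul_eq_mul]
      linear_combination g x * hst)⟩
  have hcont : ∀ x, ContinuousOn (fun l => g x + l * (Φ x - r)) (Icc l₁ l₂) := fun x => by fun_prop
  have heq : ∀ l x, g x + l * (Φ x - r) = g x + l * Φ x + -(l * r) := fun l x => by ring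
  have hξ' : ∀ l ∈ Icc l₁ l₂, IsStrictMin (fun x => g x + l * (Φ x - r)) (ξ l) := by
    intro l hl u hu
    have := hξ l hl u hu
    simp only at this ⊢
    linarith
  -- The function is affine in `l`, so a saddle point has slope `Φ - r = 0` unless `p` is an
  -- endpoint, which `h₁` and `h₂` exclude.
  obtain ⟨p, hp, h⟩ := exists_saddle (f := fun x l => g x + l * (Φ x - r))
    (nonempty_Icc.2 hl) (convex_Icc l₁ l₂) isCompact_Icc
    (fun x => (hconc x).quasiconcaveOn) (fun x => .of_concaveOn (hconc x))
    (fun l hl => by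
      simp only [heq]
      exact (hg.add_mul_const hΦ (hl₁.trans hl.1)).add lowerSemicontinuous_const)
    (fun l hl c => by
      convert hcpt l hl (c + l * r) using 1
      ext x
      simp only [mem_preimage, mem_Iic, heq]
      constructor <;> intro h <;> linarith)
    hξ' (upperSemicontinuousOn_marginal hcont hξ')
  have hle : ∀ l ∈ Icc l₁ l₂, (l - p) * (Φ (ξ p) - r) ≤ 0 := fun l hl => by
    have := h l hl
    linarith
  refine ⟨p, hp, le_antisymm ?_ ?_⟩
  · by_contra! hlt
    have h3 := hle l₂ ⟨hl, le_rfl⟩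
    have : p = l₂ := le_antisymm hp.2 (by nlinarith)
    rw [this] at hlt
    exact lt_asymm hlt h₂
  · by_contra! hlt
    have h3 := hle l₁ ⟨le_rfl, hl⟩
    have : p = l₁ := le_antisymm (by nlinarith) hp.1
    rw [this] at hlt
    exact lt_asymm hlt h₁

lemma exists_multiplier (hg : LowerSemicontinuous g) (hΦ : LowerSemicontinuous Φ)
    {a b : ℝ≥0∞} (hab : a < b)
    (hcpt : ∀ l : ℝ≥0, a < l → l < b → InfCompact fun x => g x + l * Φ x)
    (huniq : ∀ l : ℝ≥0, a < l → l < b → ∃! x, IsGlobalMin (fun x => g x + l * Φ x) x)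
    {r : ℝ} (hinf : ∃ u, Φ u < r)
    (ha : ∀ x, IsGlobalMin (fun x => g x + a.toReal * Φ x) x → r < Φ x)
    (hb : b ≠ ⊤ → ∀ x, IsGlobalMin (fun x => g x + b.toReal * Φ x) x → Φ x < r) :
    ∃ l : ℝ≥0, InfCompact (fun x => g x + l * Φ x) ∧
      ∃ x, IsStrictMin (fun x => g x + l * Φ x) x ∧ Φ x = r := by
  obtain ⟨l₀, hal₀, hl₀b⟩ := ENNReal.lt_iff_exists_nnreal_btwn.1 hab
  lift a to ℝ≥0 using hab.ne_top
  simp only [ENNReal.coe_toReal, ENNReal.coe_lt_coe] at ha hal₀ hcpt huniq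
  have hstrict : ∀ l : ℝ≥0, a < l → (l : ℝ≥0∞) < b →
      ∃ x, IsStrictMin (fun x => g x + l * Φ x) x := by
    intro l h1 h2
    obtain ⟨x, hx, hx'⟩ := huniq l h1 h2
    refine ⟨x, fun u hu => lt_of_not_ge fun hle => hu (hx' u fun v => hle.trans (hx v))⟩
  obtain ⟨x₀, -⟩ := huniq l₀ hal₀ hl₀b
  have : Nonempty X := ⟨x₀⟩
  choose! η hη using hstrict
  let ξ : ℝ → X := fun l => η l.toNNReal
  have hξ : ∀ l : ℝ, (a : ℝ) < l → (l.toNNReal : ℝ≥0∞) < b →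
      IsStrictMin (fun x => g x + l * Φ x) (ξ l) := by
    intro l h1 h2
    have h3 := hη l.toNNReal (by rwa [Real.lt_toNNReal_iff_coe_lt]) h2
    rwa [Real.coe_toNNReal l (a.2.trans h1.le)] at h3
  have hK : ∀ l : ℝ, (a : ℝ) < l → (l.toNNReal : ℝ≥0∞) < b →
      InfCompact (fun x => g x + l * Φ x) := by
    intro l h1 h2
    have h3 := hcpt l.toNNReal (by rwa [Real.lt_toNNReal_iff_coe_lt]) h2
    rwa [Real.coe_toNNReal l (a.2.trans h1.le)] at h3
  have hal₀' : (a : ℝ) < l₀ := hal₀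
  have hmono : ∀ {l l' : ℝ}, l ≤ l' → (l'.toNNReal : ℝ≥0∞) < b → (l.toNNReal : ℝ≥0∞) < b :=
    fun h h' => (ENNReal.coe_le_coe.2 (Real.toNNReal_mono h)).trans_lt h'
  have hl₀b' : ((l₀ : ℝ).toNNReal : ℝ≥0∞) < b := by rwa [Real.toNNReal_coe]
  obtain ⟨l₁, hl₁, h₁⟩ := exists_gt_of_gt_on_minima_left hg hΦ a.2 hal₀' (hK l₀ hal₀' hl₀b')
    (fun l hl => (hξ l hl.1 (hmono hl.2.le hl₀b')).le) ha
  obtain ⟨l₂, hl₂, hl₂b, h₂⟩ : ∃ l₂ : ℝ, (a : ℝ) < l₂ ∧ (l₂.toNNReal : ℝ≥0∞) < b ∧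
      Φ (ξ l₂) < r := by
    induction b with
    | top =>
      obtain ⟨l, hl, h⟩ := exists_lt_of_isGlobalMin (hξ l₀ hal₀' hl₀b').le
        (fun l hl => (hξ l (hal₀'.trans hl) ENNReal.coe_lt_top).le) hinf
      exact ⟨l, hal₀'.trans hl, ENNReal.coe_lt_top, h⟩
    | coe b =>
      have hlt : ∀ l : ℝ, (l₀ : ℝ) < l → l < b → (l.toNNReal : ℝ≥0∞) < b := fun l h h' => by
        rw [ENNReal.coe_lt_coe, Real.toNNReal_lt_iff_lt_coe (l₀.2.trans h.le)]
        exact h'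
      obtain ⟨l, hl, h⟩ := exists_lt_of_lt_on_minima_right hg hΦ l₀.2
        (show (l₀ : ℝ) < b from ENNReal.coe_lt_coe.1 hl₀b) (hK l₀ hal₀' hl₀b')
        (fun l hl => (hξ l (hal₀'.trans hl.1) (hlt l hl.1 hl.2)).le) (hb ENNReal.coe_ne_top)
      exact ⟨l, hal₀'.trans hl.1, hlt l hl.1 hl.2, h⟩
  have hl₁b := hmono hl₁.2.le hl₀b'
  have hl₁₂ : l₁ ≤ l₂ := le_of_gt_of_lt (hξ l₁ hl₁.1 hl₁b) (hξ l₂ hl₂ hl₂b) h₁ h₂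
  have hmem : ∀ l ∈ Icc l₁ l₂, (a : ℝ) < l ∧ (l.toNNReal : ℝ≥0∞) < b := fun l hl =>
    ⟨hl₁.1.trans_le hl.1, hmono hl.2 hl₂b⟩
  obtain ⟨l, hl, h⟩ := exists_mem_Icc_eq hg hΦ (a.2.trans hl₁.1.le) hl₁₂
    (fun l hl => hK l (hmem l hl).1 (hmem l hl).2) (fun l hl => hξ l (hmem l hl).1 (hmem l hl).2)
    h₁ h₂
  have hl' := hmem l hl
  refine ⟨⟨l, a.2.trans hl'.1.le⟩, hK l hl'.1 hl'.2, ξ l, hξ l hl'.1 hl'.2, h⟩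

end Multiplier

/-! ### Minimax for unique minima -/

/-- A finite-family minimax property of lower semicontinuous inf-compact functions passes to
arbitrary families. -/
lemma exists_forall_le_of_finset {X E : Type*} [TopologicalSpace X] {Y : Set E}
    (hY : Y.Nonempty) {f : X → E → ℝ}
    (hlsc : ∀ y ∈ Y, LowerSemicontinuous fun x => f x y)
    (hcpt : ∀ y ∈ Y, InfCompact fun x => f x y) {ρ : ℝ}
    (hfin : ∀ s : Finset E, s.Nonempty → (s : Set E) ⊆ Y → ∃ x, ∀ y ∈ s, f x y ≤ ρ) :
    ∃ x, ∀ y ∈ Y, f x y ≤ ρ := by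
  classical
  obtain ⟨y₀, hy₀⟩ := hY
  obtain ⟨x, -, hx⟩ := (hcpt y₀ hy₀ ρ).inter_iInter_nonempty
    (fun y : Y => (fun x => f x y) ⁻¹' Iic ρ) (fun y => (hlsc y y.2).isClosed_preimage ρ)
    (fun u => by
      -- Inserting `y₀` puts `x` in the compact sublevel set where the finite intersection property
      -- is used.
      obtain ⟨x, hx⟩ := hfin (insert y₀ (u.image Subtype.val)) (Finset.insert_nonempty _ _) (by
        intro y hy
        simp only [Finset.coe_insert, Finset.coe_image, mem_insert_iff, mem_image,
          Finset.mem_coe] at hy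
        rcases hy with rfl | ⟨z, -, rfl⟩
        · exact hy₀
        · exact z.2)
      refine ⟨x, hx y₀ (Finset.mem_insert_self _ _), mem_iInter₂.2 fun y hy => ?_⟩
      exact hx y (Finset.mem_insert_of_mem (Finset.mem_image_of_mem _ hy)))
  rw [mem_iInter] at hx
  exact ⟨x, fun y hy => hx ⟨y, hy⟩⟩

/-- Minimax theorem for functions having a unique minimum point in the first variable. -/
lemma exists_forall_le {X : Type*} [TopologicalSpace X]
    {E : Type*} [AddCommGroup E] [Module ℝ E] [TopologicalSpace E]
    [IsTopologicalAddGroup E] [ContinuousSMul ℝ E] [T2Space E]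
    {Y : Set E} (hYne : Y.Nonempty) (hY : Convex ℝ Y) {f : X → E → ℝ}
    (hf : (∀ x, ContinuousOn (f x) Y ∧ QuasiconcaveOn ℝ Y (f x)) ∨ ∀ x, ConcaveOn ℝ Y (f x))
    (hlsc : ∀ y ∈ Y, LowerSemicontinuous fun x => f x y)
    (hcpt : ∀ y ∈ Y, InfCompact fun x => f x y)
    (hmin : ∀ y ∈ Y, ∃ x, IsStrictMin (fun x => f x y) x)
    {ρ₁ ρ₂ : ℝ} (hρ : ∀ y ∈ Y, ∃ x, f x y ≤ ρ₁) (hρ₁₂ : ρ₁ < ρ₂) :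
    ∃ x, ∀ y ∈ Y, f x y ≤ ρ₂ := by
  have : Nonempty X := ⟨(hmin _ hYne.some_mem).choose⟩
  choose! ξ hξ using hmin
  have hρξ : ∀ y ∈ Y, f (ξ y) y ≤ ρ₁ := fun y hy =>
    let ⟨x, hx⟩ := hρ y hy
    ((hξ y hy).le x).trans hx
  refine exists_forall_le_of_finset hYne hlsc hcpt fun s hs hsY => ?_
  rcases hf with hf | hf
  · exact exists_le_on_finite_of_continuousOn hY (fun x => (hf x).1) (fun x => (hf x).2) hlsc hcpt
      hξ (fun y hy => (hρξ y hy).trans hρ₁₂.le) s hs hsY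
  · exact exists_le_on_finite_of_concaveOn hY hf hlsc hcpt hξ hρξ hρ₁₂ s hs hsY

end RicceriMinimax

/-! ### Reduction to `S` -/

theorem theorem2p1 {X : Type*} [TopologicalSpace X]
    {E : Type*} [AddCommGroup E] [Module ℝ E] [TopologicalSpace E]
    [IsTopologicalAddGroup E] [ContinuousSMul ℝ E] [T2Space E]
    (Y : Set E) (hYne : Y.Nonempty) (hYconv : Convex ℝ Y)
    (J : X → E → ℝ) (Φ : X → ℝ) (a b : ℝ≥0∞) (hab : a < b)
    (hJ : (∀ x : X, ContinuousOn (J x) Y ∧ QuasiconcaveOn ℝ Y (J x)) ∨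
      (∀ x : X, ConcaveOn ℝ Y (J x)))
    (hαβ : RicceriMinimax.alpha J Φ Y b < RicceriMinimax.beta J Φ Y a)
    (hΦ : LowerSemicontinuous Φ)
    (hmin : ∀ l : ℝ≥0, a < (l : ℝ≥0∞) → (l : ℝ≥0∞) < b → ∀ y ∈ Y,
      LowerSemicontinuous (fun x => J x y) ∧
      RicceriMinimax.InfCompact (fun x => J x y + (l : ℝ) * Φ x) ∧
      ∃! x : X, RicceriMinimax.IsGlobalMin (fun u => J u y + (l : ℝ) * Φ u) x)
    (r : ℝ) (hαr : RicceriMinimax.alpha J Φ Y b < (r : EReal))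
    (hrβ : (r : EReal) < RicceriMinimax.beta J Φ Y a)
    (S : Set X) (hS : IsClosed S) (hS₁ : Φ ⁻¹' {r} ⊆ S) (hS₂ : S ⊆ Φ ⁻¹' Set.Iic r) :
    (⨆ y ∈ Y, ⨅ x ∈ S, (J x y : EReal)) = ⨅ x ∈ S, ⨆ y ∈ Y, (J x y : EReal) := by
  refine le_antisymm (iSup₂_le fun y hy => le_iInf₂ fun x hx =>
    (iInf₂_le x hx).trans (le_iSup₂ (f := fun y (_ : y ∈ Y) => (J x y : EReal)) y hy)) ?_
  have hmult : ∀ y ∈ Y, ∃ l : ℝ≥0, RicceriMinimax.InfCompact (fun x => J x y + l * Φ x) ∧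
      ∃ x, RicceriMinimax.IsStrictMin (fun x => J x y + l * Φ x) x ∧ Φ x = r := by
    intro y hy
    obtain ⟨l₀, hal₀, hl₀b⟩ := ENNReal.lt_iff_exists_nnreal_btwn.1 hab
    have hα := (le_iSup₂ (f := fun y (_ : y ∈ Y) => max (⨅ x : X, (Φ x : EReal))
      (⨆ x ∈ RicceriMinimax.minSet J Φ b y, (Φ x : EReal))) y hy).trans_lt hαr
    have hβ := hrβ.trans_le (iInf₂_le (f := fun y (_ : y ∈ Y) => min (⨆ x : X, (Φ x : EReal))
      (⨅ x ∈ RicceriMinimax.minSet J Φ a y, (Φ x : EReal))) y hy)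
    rw [max_lt_iff] at hα
    rw [lt_min_iff] at hβ
    refine RicceriMinimax.exists_multiplier (hmin l₀ hal₀ hl₀b y hy).1 hΦ hab
      (fun l h1 h2 => (hmin l h1 h2 y hy).2.1) (fun l h1 h2 => (hmin l h1 h2 y hy).2.2) ?_ ?_ ?_
    · obtain ⟨u, hu⟩ := iInf_lt_iff.1 hα.1
      exact ⟨u, EReal.coe_lt_coe_iff.1 hu⟩
    · intro x hx
      exact EReal.coe_lt_coe_iff.1 (hβ.2.trans_le (iInf₂_le x ⟨hab.ne_top, hx⟩))
    · intro hb x hx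
      exact EReal.coe_lt_coe_iff.1 ((le_iSup₂ (f := fun x
        (_ : x ∈ RicceriMinimax.minSet J Φ b y) => (Φ x : EReal)) x ⟨hb, hx⟩).trans_lt hα.2)
  have hSr : ∀ x : S, Φ x ≤ r := fun x => hS₂ x.2
  have hmin' : ∀ y ∈ Y, ∃ x : S, RicceriMinimax.IsStrictMin (fun x : S => J x y) x := by
    intro y hy
    obtain ⟨l, -, x, hx, hxr⟩ := hmult y hy
    refine ⟨⟨x, hS₁ hxr⟩, fun u hu => ?_⟩
    have h1 := hx u fun h => hu (Subtype.ext h)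
    have h2 := mul_le_mul_of_nonneg_left (hSr u) l.2
    simp only [hxr] at h1
    change (l : ℝ) * _ ≤ l * _ at h2
    change J x y < J u y
    linarith
  have hlsc' : ∀ y ∈ Y, LowerSemicontinuous fun x : S => J x y := by
    intro y hy
    obtain ⟨l₀, hal₀, hl₀b⟩ := ENNReal.lt_iff_exists_nnreal_btwn.1 hab
    exact (hmin l₀ hal₀ hl₀b y hy).1.comp continuous_subtype_val
  have hcpt' : ∀ y ∈ Y, RicceriMinimax.InfCompact fun x : S => J x y := by
    intro y hy c
    obtain ⟨l, hl, -⟩ := hmult y hy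
    refine (hS.isClosedEmbedding_subtypeVal.isCompact_preimage (hl (c + l * r))).of_isClosed_subset
      ((hlsc' y hy).isClosed_preimage c) fun x hx => ?_
    have h2 := mul_le_mul_of_nonneg_left (hSr x) l.2
    exact add_le_add hx h2
  by_contra! hlt
  obtain ⟨ρ₁, hρ₁, hlt⟩ := EReal.lt_iff_exists_real_btwn.1 hlt
  -- A second real leaves room for the loss incurred in the concave case.
  obtain ⟨ρ₂, hρ₁₂, hρ₂⟩ := EReal.lt_iff_exists_real_btwn.1 hlt
  obtain ⟨x, hx⟩ := RicceriMinimax.exists_forall_le (f := fun (x : S) y => J x y) hYne hYconv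
    (hJ.imp (fun h x => h x) fun h x => h x) hlsc' hcpt' hmin' (ρ₁ := ρ₁) (ρ₂ := ρ₂) (by
      intro y hy
      have h1 := (le_iSup₂ (f := fun y (_ : y ∈ Y) => ⨅ x ∈ S, (J x y : EReal)) y hy).trans_lt hρ₁
      obtain ⟨x, h2⟩ := iInf_lt_iff.1 h1
      obtain ⟨hxS, h3⟩ := iInf_lt_iff.1 h2
      exact ⟨⟨x, hxS⟩, (EReal.coe_lt_coe_iff.1 h3).le⟩) (EReal.coe_lt_coe_iff.1 hρ₁₂)
  refine hρ₂.not_ge ((iInf₂_le (x : X) x.2).trans (iSup₂_le fun y hy => ?_))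
  exact EReal.coe_le_coe_iff.2 (hx y hy)
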